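/- The quotient complexity $\kappa(L)$ of a language $L\subseteq\Sigma^*$ is the number of its distinct left quotients $\{x\in\Sigma^* \mid wx\in L\}$, $w\in\Sigma^*$. Star-free languages are the members of the smallest class that contains the finite languages and is closed under the boolean operations and concatenation. A DFA is aperiodic if no word performs a permutation, other than the identity permutation, of a subset of its set of states. Alphabets are finite and non-empty. For every $n\ge 2$ there is a star-free language $L$ over the four-letter alphabet $\{a,b,c,d\}$ with $\kappa(L)=n$ and $\kappa(L^*)=2^{n-1}+2^{n-2}$. For every $n\ge 3$ a witness is the language accepted by the aperiodic DFA ${\mathcal D}_n(a,b,c,d)$ with states $1,\dots,n$, initial state $1$, single accepting state $n-1$, and transitions $\delta(i,a)=\min(i+1,n)$; $\delta(i,b)=\max(i-1,1)$; $\delta(i,c)=\max(i-1,1)$ for $i\le n-1$ and $\delta(n,c)=n$; $\delta(i,d)=n$. The value $2^{n-1}+2^{n-2}$ is also the upper bound for regular languages: if $n\ge 2$ and $L$ is a regular language over any alphabet with $\kappa(L)=n$, then $\kappa(L^*)\le 2^{n-1}+2^{n-2}$. For $n=1$ the tight upper bound is $2$: over every alphabet, $2$ is the maximum of $\kappa(L^*)$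 over all star-free languages $L$ with $\kappa(L)=1$. -/

import Mathlib

open scoped Computability

/-- The star-free languages over an alphabet: the smallest class of languages that contains the
finite languages and is closed under the boolean operations and concatenation (closure under
intersection, difference and symmetric difference follows from union and complement). -/
inductive IsStarFree {α : Type*} : Language α → Prop
  | finite (L : Language α) (hL : Set.Finite {w : List α | w ∈ L}) : IsStarFree L
  | union (K L : Language α) (hK : IsStarFree K) (hL : IsStarFree L) : IsStarFree (K + L)
  | compl (L : Language α) (hL : IsStarFree L) : IsStarFree Lᶜ
  | concat (K L : Language α) (hK : IsStarFree K) (hL : IsStarFree L) : IsStarFree (K * L)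

/-- The quotient complexity of a language: the number (possibly infinite) of its distinct left
quotients by words. -/
noncomputable def quotientComplexity {α : Type*} (L : Language α) : ℕ∞ :=
  (Set.range L.leftQuotient).encard

/-- A DFA is aperiodic if no word performs a permutation, other than the identity permutation, of
a subset of the set of states. -/
def IsAperiodicDFA {α σ : Type*} (M : DFA α σ) : Prop :=
  ∀ (w : List α) (S : Set σ), Set.BijOn (fun q => M.evalFrom q w) S S →
    ∀ q ∈ S, M.evalFrom q w = q

/-- The four-letter alphabet `{a, b, c, d}`. -/
inductive Letter : Type
  | a
  | b
  | c
  | d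

/-- The transition function of the `n`-state witness automaton. The state `i : Fin n` (so
`0 ≤ i ≤ n - 1`) stands for the state `i + 1` of `{1, …, n}`. The letter `a` moves one state up
(the last state is fixed), `b` moves one state down (the first state is fixed), `c` moves one
state down but fixes both the first and the last state, and `d` moves every state to the last. -/
def starWitnessStep {n : ℕ} (i : Fin n) : Letter → Fin n
  | .a => ⟨min (i.val + 1) (n - 1), by have := i.isLt; omega⟩
  | .b => ⟨i.val - 1, by have := i.isLt; omega⟩
  | .c => if i.val = n - 1 then i else ⟨i.val - 1, by have := i.isLt; omega⟩
  | .d => ⟨n - 1, by have := i.isLt; omega⟩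

/-- The automaton `D_n(a, b, c, d)`, for `n ≥ 3`: the initial state is the first one, and the only
accepting state is the last but one. -/
def starWitness (n : ℕ) (hn : 3 ≤ n) : DFA Letter (Fin n) where
  step := starWitnessStep
  start := ⟨0, by omega⟩
  accept := {⟨n - 2, by omega⟩}

/-!
Star-freeness of a finite aperiodic automaton is Schützenberger's theorem, proved by induction on
the transition monoid `M` and the alphabet: if some letter `c` has a value other than `1`, cut the
words at the occurrences of `c`. The parts between two of them avoid `c`, and as letters of the
local divisor of `M` at `c`, which is again aperiodic and smaller than `M`, they are covered by
induction.

The upper bound counts the reachable states of the subset automaton that adds the initial state `s`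
whenever it meets an accepting state `f`: they are nonempty and contain `s` if they contain `f`,
and the empty word contributes one further quotient. When no state other than `s` accepts, the
bound is trivial.

For the witness all these sets are reachable: starting from the last state alone, `a` shifts a set
upwards, and `ba` restores the set except that it inserts the second state, so sets containing the
last state are built element by element; `c` and shifts by `a` or `b` lead to the others. The
words `a ^ k` and `b` tell the sets apart.
-/

/-! ### Star-free languages of aperiodic automata -/

/-- The language of all words over a subset `B` of the alphabet. -/
def wordsOver {α : Type*} (B : Set α) : Language α := {w | ∀ x ∈ w, x ∈ B}

theorem mem_wordsOver {α : Type*} {B : Set α} {w : List α} : w ∈ wordsOver B ↔ ∀ x ∈ w, x ∈ B :=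
  Iff.rfl

theorem mem_top_mul_singleton_mul_top {α : Type*} {x : α} {w : List α} :
    w ∈ (⊤ : Language α) * {[x]} * ⊤ ↔ x ∈ w := by
  constructor
  · rintro ⟨_, ⟨s, -, _, rfl, rfl⟩, t, -, rfl⟩
    exact show x ∈ s ++ [x] ++ t by simp
  · intro hx
    obtain ⟨s, t, rfl⟩ := List.append_of_mem hx
    exact ⟨s ++ [x], ⟨s, trivial, [x], rfl, rfl⟩, t, trivial, by simp⟩

namespace IsStarFree

variable {α : Type*} {K L : Language α}

theorem zero : IsStarFree (0 : Language α) := .finite _ Set.finite_empty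

theorem top : IsStarFree (⊤ : Language α) := by
  rw [← compl_bot]
  exact zero.compl

theorem singleton (w : List α) : IsStarFree ({w} : Language α) :=
  .finite _ (Set.finite_singleton w)

theorem inf (hK : IsStarFree K) (hL : IsStarFree L) : IsStarFree (K ⊓ L) := by
  have h := (hK.compl.union _ _ hL.compl).compl
  rwa [add_eq_sup, compl_sup, compl_compl, compl_compl] at h

theorem biSup {ι : Type*} {S : Set ι} (hS : S.Finite) {L : ι → Language α}
    (hL : ∀ i ∈ S, IsStarFree (L i)) : IsStarFree (⨆ i ∈ S, L i) := by
  induction S, hS using Set.Finite.induction_on with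
  | empty =>
    rw [iSup_emptyset]
    exact zero
  | insert _ _ ih =>
    rw [iSup_insert, ← add_eq_sup]
    exact (hL _ (Set.mem_insert _ _)).union _ _ (ih fun j hj => hL j (Set.mem_insert_of_mem _ hj))

theorem top_mul_singleton_mul_top (w : List α) : IsStarFree ((⊤ : Language α) * {w} * ⊤) :=
  (top.concat _ _ (singleton w)).concat _ _ top

theorem wordsOver [Finite α] (B : Set α) : IsStarFree (wordsOver B) := by
  have h : _root_.wordsOver B = (⨆ x ∈ Bᶜ, (⊤ : Language α) * {[x]} * ⊤)ᶜ := by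
    ext w
    change (∀ x ∈ w, x ∈ B) ↔ w ∉ ⨆ x ∈ Bᶜ, (⊤ : Language α) * {[x]} * ⊤
    simp only [Language.mem_iSup, mem_top_mul_singleton_mul_top, not_exists]
    exact forall_congr' fun x => ⟨fun h hx hxw => hx (h hxw), fun h hxw => by_contra (h · hxw)⟩
  rw [h]
  exact (biSup (Set.toFinite Bᶜ) fun x _ => top_mul_singleton_mul_top [x]).compl

end IsStarFree

/-- A monoid is aperiodic if the powers of each of its elements are eventually constant. -/
def IsAperiodicMonoid (M : Type*) [Monoid M] : Prop :=
  ∀ x : M, ∃ k, x ^ (k + 1) = x ^ k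

theorem IsAperiodicMonoid.eq_one_of_mul_eq_one {M : Type*} [Monoid M] (hM : IsAperiodicMonoid M)
    {x c : M} (h : x * c = 1) : c = 1 := by
  obtain ⟨k, hk⟩ := hM c
  have hpow : x ^ k * c ^ k = 1 := pow_mul_pow_eq_one k h
  calc c = x ^ k * c ^ k * c := by rw [hpow, one_mul]
    _ = x ^ k * c ^ k := by rw [mul_assoc, ← pow_succ, hk]
    _ = 1 := hpow

/-- The local divisor of a monoid `M` at `c`, due to Diekert and Gastin: the set `M c ∩ c M` with
the product `x c ∘ c y = x c y`, in which `c` is the neutral element. -/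
def LocalDivisor {M : Type*} [Monoid M] (c : M) : Type _ :=
  {m : M // (∃ x, m = x * c) ∧ ∃ y, m = c * y}

namespace LocalDivisor

variable {M : Type*} [Monoid M] {c : M}

instance [Finite M] : Finite (LocalDivisor c) := Subtype.finite

noncomputable instance : Mul (LocalDivisor c) where
  mul m m' := ⟨m.2.1.choose * m'.1, by
    obtain ⟨x, hx⟩ := m'.2.1
    exact ⟨m.2.1.choose * x, by rw [mul_assoc, ← hx]⟩, by
    obtain ⟨y, hy⟩ := m'.2.2
    obtain ⟨z, hz⟩ := m.2.2
    exact ⟨z * y, by rw [← mul_assoc, ← hz, hy, ← mul_assoc, ← m.2.1.choose_spec]⟩⟩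

theorem val_mul {m m' : LocalDivisor c} {x : M} (hx : m.1 = x * c) : (m * m').1 = x * m'.1 := by
  obtain ⟨y, hy⟩ := m'.2.2
  change m.2.1.choose * m'.1 = x * m'.1
  rw [hy, ← mul_assoc, ← mul_assoc, ← hx, ← m.2.1.choose_spec]

instance : One (LocalDivisor c) where
  one := ⟨c, ⟨1, (one_mul c).symm⟩, ⟨1, (mul_one c).symm⟩⟩

theorem val_one : (1 : LocalDivisor c).1 = c := rfl

noncomputable instance : Monoid (LocalDivisor c) where
  mul_assoc m m' m'' := by
    obtain ⟨x, hx⟩ := m.2.1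
    obtain ⟨x', hx'⟩ := m'.2.1
    have h : (m * m').1 = x * x' * c := by rw [val_mul hx, hx', mul_assoc]
    exact Subtype.ext (by rw [val_mul h, val_mul hx, val_mul hx', mul_assoc])
  one_mul m := Subtype.ext (by rw [val_mul (x := 1) (by rw [val_one, one_mul]), one_mul])
  mul_one m := by
    obtain ⟨x, hx⟩ := m.2.1
    exact Subtype.ext (by rw [val_mul hx, val_one, hx])

theorem val_pow {m : LocalDivisor c} {x : M} (hx : m.1 = x * c) (k : ℕ) :
    (m ^ k).1 = x ^ k * c := by
  induction k with
  | zero => rw [pow_zero, pow_zero, one_mul, val_one]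
  | succ k ih => rw [pow_succ', val_mul hx, ih, pow_succ', mul_assoc]

theorem isAperiodicMonoid (hM : IsAperiodicMonoid M) : IsAperiodicMonoid (LocalDivisor c) := by
  intro m
  obtain ⟨x, hx⟩ := m.2.1
  obtain ⟨k, hk⟩ := hM x
  exact ⟨k, Subtype.ext (by rw [val_pow hx, val_pow hx, hk])⟩

theorem card_lt [Finite M] (hM : IsAperiodicMonoid M) (hc : c ≠ 1) :
    Nat.card (LocalDivisor c) < Nat.card M := by
  refine Finite.card_subtype_lt (x := 1) ?_
  rintro ⟨⟨x, hx⟩, -⟩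
  exact hc (hM.eq_one_of_mul_eq_one hx.symm)

/-- The map `m ↦ c m c` into the local divisor at `c`. It turns a factor of a word between two
letters of value `c` into a letter of the local divisor. -/
def sandwich (c : M) (m : M) : LocalDivisor c :=
  ⟨c * m * c, ⟨c * m, rfl⟩, ⟨m * c, mul_assoc _ _ _⟩⟩

end LocalDivisor

section Blocks

variable {α : Type*} {B : Set α} {c : α}

/-- The word obtained by writing the letter `c` after each of the given blocks. -/
def closeBlocks (c : α) (us : List (List α)) : List α :=
  us.flatMap (· ++ [c])

@[simp]
theorem closeBlocks_nil : closeBlocks c [] = [] := rfl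

@[simp]
theorem closeBlocks_cons (u : List α) (us : List (List α)) :
    closeBlocks c (u :: us) = u ++ c :: closeBlocks c us := by
  simp [closeBlocks]

@[simp]
theorem closeBlocks_append (us vs : List (List α)) :
    closeBlocks c (us ++ vs) = closeBlocks c us ++ closeBlocks c vs :=
  List.flatMap_append

theorem append_cons_inj_of_notMem {u v x y : List α} (hu : c ∉ u) (hv : c ∉ v)
    (h : u ++ c :: x = v ++ c :: y) : u = v ∧ x = y := by
  induction u generalizing v with
  | nil => cases v <;> grind
  | cons a u ih => cases v <;> grind

theorem injOn_closeBlocks : Set.InjOn (closeBlocks c) {us | ∀ u ∈ us, c ∉ u} := by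
  intro us hus vs hvs h
  induction us generalizing vs with
  | nil => cases vs <;> simp_all
  | cons u us ih =>
    cases vs with
    | nil => simp at h
    | cons v vs =>
      simp only [closeBlocks_cons] at h
      obtain ⟨rfl, hcl⟩ := append_cons_inj_of_notMem (hus u (by simp)) (hvs v (by simp)) h
      rw [ih (fun x hx => hus x (List.mem_cons_of_mem _ hx))
        (fun x hx => hvs x (List.mem_cons_of_mem _ hx)) hcl]

theorem closeBlocks_mem_wordsOver {us : List (List α)} (hus : ∀ u ∈ us, u ∈ wordsOver B) :
    closeBlocks c us ∈ wordsOver (insert c B) := by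
  intro x hx
  obtain ⟨u, hu, hx⟩ := List.mem_flatMap.1 hx
  rcases List.mem_append.1 hx with hx | hx
  · exact Or.inr (hus u hu x hx)
  · exact Or.inl (List.mem_singleton.1 hx)

theorem exists_eq_closeBlocks_append {w : List α} (hw : w ∈ wordsOver (insert c B)) :
    ∃ us u, (∀ v ∈ us, v ∈ wordsOver B) ∧ u ∈ wordsOver B ∧ w = closeBlocks c us ++ u := by
  simp only [mem_wordsOver] at hw ⊢
  induction w with
  | nil => exact ⟨[], [], by simp⟩
  | cons x w ih =>
    simp only [List.forall_mem_cons] at hw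
    obtain ⟨us, u, hus, hu, rfl⟩ := ih hw.2
    rcases hw.1 with rfl | hx
    · exact ⟨[] :: us, u, by simpa using hus, hu, by simp⟩
    · cases us with
      | nil => exact ⟨[], x :: u, by simp, by simpa using ⟨hx, hu⟩, by simp⟩
      | cons v us =>
        simp only [List.forall_mem_cons] at hus
        exact ⟨(x :: v) :: us, u, by simpa using ⟨⟨hx, hus.1⟩, hus.2⟩, hu, by simp⟩

variable {M : Type*} [Monoid M] {h : α → M}

/-- The value of a word in a monoid, for given values `h` of the letters. -/
def wordValue (h : α → M) (w : List α) : M :=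
  (w.map h).prod

@[simp]
theorem wordValue_nil : wordValue h [] = 1 := rfl

@[simp]
theorem wordValue_cons (x : α) (w : List α) : wordValue h (x :: w) = h x * wordValue h w :=
  List.prod_cons

@[simp]
theorem wordValue_append (v w : List α) :
    wordValue h (v ++ w) = wordValue h v * wordValue h w := by
  simp [wordValue]

theorem mul_wordValue_closeBlocks (us : List (List α)) :
    h c * wordValue h (closeBlocks c us) =
      (wordValue (LocalDivisor.sandwich (h c)) (us.map (wordValue h))).1 := by
  induction us with
  | nil => simp [LocalDivisor.val_one]
  | cons u us ih =>
    rw [List.map_cons, wordValue_cons,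
      LocalDivisor.val_mul (x := h c * wordValue h u) rfl, ← ih]
    simp [mul_assoc]

/-- The words over `B` of value `m`. -/
def valueLanguage (h : α → M) (B : Set α) (m : M) : Language α :=
  {w | w ∈ wordsOver B ∧ wordValue h w = m}

/-- The words that consist of blocks over `B`, each followed by `c`, for which the sequence of the
values of the blocks is a word of `K`. -/
def blockPullback (h : α → M) (c : α) (B : Set α) (K : Language M) : Language α :=
  closeBlocks c '' {us | (∀ u ∈ us, u ∈ wordsOver B) ∧ us.map (wordValue h) ∈ K}

theorem mem_blockPullback {K : Language M} {w : List α} :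
    w ∈ blockPullback h c B K ↔
      ∃ us, ((∀ u ∈ us, u ∈ wordsOver B) ∧ us.map (wordValue h) ∈ K) ∧ closeBlocks c us = w :=
  Iff.rfl

theorem blockPullback_iSup {ι : Sort*} (K : ι → Language M) :
    blockPullback h c B (⨆ i, K i) = ⨆ i, blockPullback h c B (K i) := by
  ext w
  simp only [Language.mem_iSup, mem_blockPullback]
  grind

theorem blockPullback_add (K L : Language M) :
    blockPullback h c B (K + L) = blockPullback h c B K + blockPullback h c B L := by
  ext w
  simp only [Language.mem_add, mem_blockPullback]
  grind

theorem blockPullback_mul (K L : Language M) :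
    blockPullback h c B (K * L) = blockPullback h c B K * blockPullback h c B L := by
  ext w
  constructor
  · rintro ⟨us, ⟨hus, k, hk, l, hl, hkl⟩, rfl⟩
    obtain ⟨vs, ws, rfl, rfl, rfl⟩ := List.map_eq_append_iff.1 hkl.symm
    rw [List.forall_mem_append] at hus
    exact ⟨_, ⟨vs, ⟨hus.1, hk⟩, rfl⟩, _, ⟨ws, ⟨hus.2, hl⟩, rfl⟩, by simp⟩
  · rintro ⟨_, ⟨vs, ⟨hvs, hk⟩, rfl⟩, _, ⟨ws, ⟨hws, hl⟩, rfl⟩, rfl⟩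
    exact ⟨vs ++ ws, ⟨List.forall_mem_append.2 ⟨hvs, hws⟩, _, hk, _, hl, by simp⟩, by simp⟩

theorem blockPullback_singleton_nil : blockPullback h c B {[]} = {[]} := by
  ext w
  constructor
  · rintro ⟨us, ⟨-, hus⟩, rfl⟩
    rw [List.map_eq_nil_iff.1 hus]
    rfl
  · rintro rfl
    exact ⟨[], ⟨by simp, rfl⟩, rfl⟩

theorem blockPullback_singleton_singleton (m : M) :
    blockPullback h c B {[m]} = valueLanguage h B m * {[c]} := by
  ext w
  constructor
  · rintro ⟨us, ⟨hus, hm⟩, rfl⟩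
    obtain ⟨u, rfl, rfl⟩ := List.map_eq_singleton_iff.1 hm
    exact ⟨u, ⟨hus u (by simp), rfl⟩, [c], rfl, by simp⟩
  · rintro ⟨u, ⟨hu, rfl⟩, _, rfl, rfl⟩
    exact ⟨[u], ⟨by simpa using hu, rfl⟩, by simp⟩

theorem blockPullback_top :
    blockPullback h c B ⊤ = wordsOver (insert c B) ⊓ (1 + (⊤ : Language α) * {[c]}) := by
  ext w
  constructor
  · rintro ⟨us, ⟨hus, -⟩, rfl⟩
    refine ⟨closeBlocks_mem_wordsOver hus, ?_⟩
    rcases List.eq_nil_or_concat us with rfl | ⟨us, u, rfl⟩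
    · exact Or.inl rfl
    · exact Or.inr ⟨closeBlocks c us ++ u, trivial, [c], rfl, by simp⟩
  · rintro ⟨hw, rfl | ⟨v, -, _, rfl, rfl⟩⟩
    · exact ⟨[], ⟨by simp, trivial⟩, rfl⟩
    · obtain ⟨us, u, hus, hu, rfl⟩ :=
        exists_eq_closeBlocks_append fun x hx => hw x (List.mem_append_left _ hx)
      exact ⟨us ++ [u], ⟨List.forall_mem_append.2 ⟨hus, by simpa using hu⟩, trivial⟩, by simp⟩

theorem blockPullback_compl (hc : c ∉ B) (K : Language M) :
    blockPullback h c B Kᶜ = blockPullback h c B ⊤ ⊓ (blockPullback h c B K)ᶜ := by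
  have hB : ∀ us : List (List α), (∀ u ∈ us, u ∈ wordsOver B) → ∀ u ∈ us, c ∉ u :=
    fun us hus u hu hcu => hc (hus u hu c hcu)
  ext w
  constructor
  · rintro ⟨us, ⟨hus, hK⟩, rfl⟩
    refine ⟨⟨us, ⟨hus, trivial⟩, rfl⟩, ?_⟩
    rintro ⟨vs, ⟨hvs, hK'⟩, h'⟩
    obtain rfl := injOn_closeBlocks (hB vs hvs) (hB us hus) h'
    exact hK hK'
  · rintro ⟨⟨us, ⟨hus, -⟩, rfl⟩, hK⟩
    exact ⟨us, ⟨hus, fun h' => hK ⟨us, ⟨hus, h'⟩, rfl⟩⟩, rfl⟩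

theorem isStarFree_blockPullback_singleton (hB : ∀ m, IsStarFree (valueLanguage h B m))
    (v : List M) : IsStarFree (blockPullback h c B {v}) := by
  induction v with
  | nil =>
    rw [blockPullback_singleton_nil]
    exact .singleton []
  | cons m v ih =>
    have hmv : ({m :: v} : Language M) = {[m]} * {v} :=
      (Set.image2_singleton (f := (· ++ ·)) (a := [m]) (b := v)).symm
    rw [hmv, blockPullback_mul, blockPullback_singleton_singleton]
    exact ((hB m).concat _ _ (.singleton [c])).concat _ _ ih

theorem isStarFree_blockPullback [Finite α] (hc : c ∉ B)
    (hB : ∀ m, IsStarFree (valueLanguage h B m)) {K : Language M} (hK : IsStarFree K) :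
    IsStarFree (blockPullback h c B K) := by
  induction hK with
  | finite K hK =>
    have hK' : K = ⨆ v ∈ K, ({v} : Language M) := (Set.biUnion_of_singleton K).symm
    rw [hK']
    simp only [blockPullback_iSup]
    exact .biSup hK fun v _ => isStarFree_blockPullback_singleton hB v
  | union K L _ _ hK hL =>
    rw [blockPullback_add]
    exact hK.union _ _ hL
  | compl K _ hK =>
    rw [blockPullback_compl hc, blockPullback_top]
    exact ((IsStarFree.wordsOver _).inf ((IsStarFree.singleton []).union _ _
      (IsStarFree.top.concat _ _ (.singleton [c])))).inf hK.compl
  | concat K L _ _ hK hL =>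
    rw [blockPullback_mul]
    exact hK.concat _ _ hL

theorem wordValue_append_closeBlocks_append (v u : List α) (us : List (List α)) :
    wordValue h (v ++ [c] ++ closeBlocks c us ++ u) =
      wordValue h v * (wordValue (LocalDivisor.sandwich (h c)) (us.map (wordValue h))).1 *
        wordValue h u := by
  simp [← mul_wordValue_closeBlocks, mul_assoc]

theorem valueLanguage_insert (h : α → M) (c : α) (B : Set α) (m : M) :
    valueLanguage h (insert c B) m = valueLanguage h B m +
      ⨆ p ∈ {p : M × LocalDivisor (h c) × M | p.1 * p.2.1.1 * p.2.2 = m},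
        valueLanguage h B p.1 * {[c]} *
          blockPullback h c B (valueLanguage (LocalDivisor.sandwich (h c)) Set.univ p.2.1) *
          valueLanguage h B p.2.2 := by
  ext w
  simp only [Language.mem_add, Language.mem_iSup]
  constructor
  · rintro ⟨hw, rfl⟩
    obtain ⟨us, u, hus, hu, rfl⟩ := exists_eq_closeBlocks_append hw
    cases us with
    | nil => exact Or.inl ⟨hu, rfl⟩
    | cons v us =>
      rw [List.forall_mem_cons] at hus
      refine Or.inr ⟨(wordValue h v, wordValue (.sandwich (h c)) (us.map (wordValue h)),
        wordValue h u), ?_, ?_⟩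
      · simp [← wordValue_append_closeBlocks_append]
      · exact ⟨v ++ [c] ++ closeBlocks c us, ⟨v ++ [c], ⟨v, ⟨hus.1, rfl⟩, [c], rfl, rfl⟩, _,
          ⟨us, ⟨hus.2, fun _ _ => trivial, rfl⟩, rfl⟩, rfl⟩, u, ⟨hu, rfl⟩, by simp⟩
  · rintro (⟨hw, rfl⟩ | ⟨⟨m₁, m₂, m₃⟩, hm, _, ⟨_, ⟨v, ⟨hv, rfl⟩, _, rfl, rfl⟩, _,
      ⟨us, ⟨hus, -, rfl⟩, rfl⟩, rfl⟩, u, ⟨hu, rfl⟩, rfl⟩)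
    · exact ⟨fun x hx => Or.inr (hw x hx), rfl⟩
    · refine ⟨?_, (wordValue_append_closeBlocks_append v u us).trans hm⟩
      have hcB : closeBlocks c us ∈ wordsOver (insert c B) := closeBlocks_mem_wordsOver hus
      simp only [mem_wordsOver, List.forall_mem_append, Set.mem_insert_iff] at hv hu hcB ⊢
      exact ⟨⟨⟨fun x hx => Or.inr (hv x hx), by simp⟩, hcB⟩, fun x hx => Or.inr (hu x hx)⟩

end Blocks

theorem isStarFree_valueLanguage_of_eq_one {α M : Type*} [Finite α] [Monoid M] {h : α → M}
    {B : Set α} (hB : ∀ x ∈ B, h x = 1) (m : M) : IsStarFree (valueLanguage h B m) := by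
  have hv : ∀ w ∈ wordsOver B, wordValue h w = 1 := fun w hw =>
    List.prod_eq_one (by simpa using fun x hx => hB x (hw x hx))
  by_cases hm : m = 1
  · have heq : valueLanguage h B m = wordsOver B :=
      Set.ext fun w => ⟨And.left, fun hw => ⟨hw, (hv w hw).trans hm.symm⟩⟩
    exact heq ▸ .wordsOver B
  · have heq : valueLanguage h B m = 0 :=
      Set.eq_empty_of_forall_notMem fun w hw => hm (hw.2.symm.trans (hv w hw.1))
    exact heq ▸ .zero

theorem isStarFree_valueLanguage_of_localDivisor {α M : Type*} [Finite α] [Monoid M] [Finite M]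
    (hloc : ∀ c : M, c ≠ 1 → ∀ m : LocalDivisor c,
      IsStarFree (valueLanguage (LocalDivisor.sandwich c) Set.univ m))
    (h : α → M) (B : Set α) (m : M) : IsStarFree (valueLanguage h B m) := by
  induction hk : B.ncard using Nat.strong_induction_on generalizing B m with
  | _ k ih =>
  subst hk
  by_cases hB : ∀ x ∈ B, h x = 1
  · exact isStarFree_valueLanguage_of_eq_one hB m
  · push Not at hB
    obtain ⟨c, hcB, hc⟩ := hB
    have hS : ∀ m, IsStarFree (valueLanguage h (B \ {c}) m) := fun m =>
      ih _ (Set.ncard_sdiff_singleton_lt_of_mem hcB) _ m rfl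
    rw [← Set.insert_sdiff_self_of_mem hcB, valueLanguage_insert]
    exact (hS m).union _ _ (.biSup (Set.toFinite _) fun p _ => (((hS p.1).concat _ _
      (.singleton [c])).concat _ _ (isStarFree_blockPullback (by simp) hS
        (hloc (h c) hc p.2.1))).concat _ _ (hS p.2.2))

theorem IsAperiodicMonoid.isStarFree_valueLanguage_sandwich {M : Type*} [Monoid M] [Finite M]
    (hM : IsAperiodicMonoid M) {c : M} (hc : c ≠ 1) (m : LocalDivisor c) :
    IsStarFree (valueLanguage (LocalDivisor.sandwich c) Set.univ m) := by
  induction hn : Nat.card M using Nat.strong_induction_on generalizing M with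
  | _ n ih =>
  subst hn
  exact isStarFree_valueLanguage_of_localDivisor (fun d hd m =>
    ih _ (LocalDivisor.card_lt hM hc) (LocalDivisor.isAperiodicMonoid hM) hd m rfl) _ _ m

theorem IsAperiodicMonoid.isStarFree_valueLanguage {α M : Type*} [Finite α] [Monoid M] [Finite M]
    (hM : IsAperiodicMonoid M) (h : α → M) (B : Set α) (m : M) :
    IsStarFree (valueLanguage h B m) :=
  isStarFree_valueLanguage_of_localDivisor
    (fun _ hc => hM.isStarFree_valueLanguage_sandwich hc) h B m

theorem IsAperiodicDFA.exists_iterate_succ_eq {α σ : Type*} [Finite σ] {M : DFA α σ}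
    (hM : IsAperiodicDFA M) (w : List α) :
    ∃ k, (fun q => M.evalFrom q w)^[k + 1] = (fun q => M.evalFrom q w)^[k] := by
  set f : σ → σ := fun q => M.evalFrom q w
  obtain ⟨i, j, hij, hf⟩ := Finite.exists_ne_map_eq_of_infinite fun k : ℕ => f^[k]
  wlog hlt : i < j generalizing i j
  · exact this j i hij.symm hf.symm (by omega)
  refine ⟨i, funext fun q => ?_⟩
  have hper : f^[i] q ∈ Function.periodicPts f := by
    refine ⟨j - i, Nat.sub_pos_of_lt hlt, ?_⟩
    change f^[j - i] (f^[i] q) = f^[i] q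
    rw [← Function.iterate_add_apply, Nat.sub_add_cancel hlt.le]
    exact (congrFun hf q).symm
  calc f^[i + 1] q = f (f^[i] q) := Function.iterate_succ_apply' f i q
    _ = f^[i] q := hM w _ (Function.bijOn_periodicPts f) _ hper

/-- The action of words on the states of an automaton, as a homomorphism to the opposite of the
monoid of all self-maps, since the first letter of a word acts first. -/
def transitionHom {α σ : Type*} (M : DFA α σ) : FreeMonoid α →* (Function.End σ)ᵐᵒᵖ :=
  FreeMonoid.lift fun x => .op fun q => M.step q x

theorem transitionHom_ofList {α σ : Type*} (M : DFA α σ) (w : List α) :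
    transitionHom M (FreeMonoid.ofList w) = .op fun q => M.evalFrom q w := by
  induction w with
  | nil => rfl
  | cons x w ih =>
    rw [FreeMonoid.ofList_cons, map_mul, ih]
    rfl

theorem IsAperiodicDFA.isAperiodicMonoid_mrange {α σ : Type*} [Finite σ] {M : DFA α σ}
    (hM : IsAperiodicDFA M) : IsAperiodicMonoid (MonoidHom.mrange (transitionHom M)) := by
  have hpow : ∀ (f : Function.End σ) (k : ℕ), f ^ k = f^[k] := fun f k => by
    induction k with
    | zero => rfl
    | succ k ih =>
      rw [pow_succ, ih]
      rfl
  rintro ⟨_, w, rfl⟩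
  obtain ⟨k, hk⟩ := hM.exists_iterate_succ_eq w.toList
  refine ⟨k, Subtype.ext (MulOpposite.unop_injective ?_)⟩
  simp only [SubmonoidClass.coe_pow, MulOpposite.unop_pow, hpow]
  exact (transitionHom_ofList M w.toList).symm ▸ hk

theorem IsAperiodicDFA.isStarFree_accepts {α σ : Type*} [Finite α] [Finite σ] {M : DFA α σ}
    (hM : IsAperiodicDFA M) : IsStarFree M.accepts := by
  have : Finite (Function.End σ)ᵐᵒᵖ := .of_equiv (σ → σ) MulOpposite.opEquiv
  let h : α → MonoidHom.mrange (transitionHom M) :=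
    fun x => (transitionHom M).mrangeRestrict (.of x)
  have hval : ∀ w, wordValue h w = (transitionHom M).mrangeRestrict (.ofList w) := fun w => by
    induction w with
    | nil => rfl
    | cons x w ih => rw [wordValue_cons, ih, FreeMonoid.ofList_cons, map_mul]
  have haccepts : M.accepts = ⨆ m ∈ {m : MonoidHom.mrange (transitionHom M) |
      m.1.unop M.start ∈ M.accept}, valueLanguage h Set.univ m := by
    ext w
    have hw : w ∈ M.accepts ↔ (wordValue h w).1.unop M.start ∈ M.accept := by
      rw [hval, MonoidHom.coe_mrangeRestrict, transitionHom_ofList]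
      rfl
    simp only [Language.mem_iSup]
    constructor
    · intro hmem
      exact ⟨wordValue h w, hw.1 hmem, fun _ _ => trivial, rfl⟩
    · rintro ⟨_, hm, -, rfl⟩
      exact hw.2 hm
  rw [haccepts]
  exact .biSup (Set.toFinite _) fun m _ =>
    hM.isAperiodicMonoid_mrange.isStarFree_valueLanguage h Set.univ m

theorem IsAperiodicDFA.of_monotone {α σ : Type*} [LinearOrder σ] [WellFoundedLT σ] {M : DFA α σ}
    (hM : ∀ x, Monotone fun q => M.step q x) : IsAperiodicDFA M := by
  intro w S hS
  have hw : Monotone fun q => M.evalFrom q w := by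
    clear hS
    induction w with
    | nil => exact monotone_id
    | cons x w ih => exact ih.comp (hM x)
  intro q hq
  let e : S ≃o S := StrictMono.orderIsoOfSurjective (hS.mapsTo.restrict _ S S)
    (Monotone.strictMono_of_injective (fun p q hpq => hw hpq) hS.bijective.1) hS.bijective.2
  have he : e = .refl S := Subsingleton.elim _ _
  exact congrArg Subtype.val (DFunLike.congr_fun he ⟨q, hq⟩)

/-! ### The iteration of a regular language -/

theorem kstar_eq_one_add {K : Type*} [KleeneAlgebra K] {a : K} (ha : a * a ≤ a) :
    a∗ = 1 + a := by
  refine le_antisymm (kstar_le_of_mul_le_left le_self_add ?_) (add_le one_le_kstar le_kstar)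
  rw [add_mul, one_mul]
  exact add_le le_add_self (ha.trans le_add_self)

section Kstar

variable {α : Type*} {L : Language α}

theorem append_mem_kstar {u v : List α} (hu : u ∈ L∗) (hv : v ∈ L) : u ++ v ∈ L∗ :=
  kstar_mul_kstar L ▸ Language.append_mem_mul hu (le_kstar (a := L) hv)

theorem append_singleton_mem_kstar_iff {w : List α} {x : α} :
    w ++ [x] ∈ L∗ ↔ ∃ u v, w = u ++ v ∧ u ∈ L∗ ∧ v ++ [x] ∈ L := by
  constructor
  · intro hw
    obtain ⟨S, hwS, hS⟩ := Language.mem_kstar_iff_exists_nonempty.1 hw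
    rcases List.eq_nil_or_concat S with rfl | ⟨S, v, rfl⟩
    · simp at hwS
    obtain ⟨hv, hne⟩ := hS v (by simp)
    obtain ⟨v, y, rfl⟩ := (List.eq_nil_or_concat v).resolve_left hne
    simp only [List.concat_eq_append, List.flatten_append, List.flatten_singleton,
      ← List.append_assoc, List.append_singleton_inj] at hwS hv
    obtain ⟨rfl, rfl⟩ := hwS
    exact ⟨S.flatten, v, rfl, Language.join_mem_kstar fun y hy => (hS y (by simp [hy])).1, hv⟩
  · rintro ⟨u, v, rfl, hu, hv⟩
    rw [List.append_assoc]
    exact append_mem_kstar hu hv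

end Kstar

/-- The subset automaton for the iteration of the language of `M`: whenever `M` accepts, the
initial state of `M` is added. The empty word aside, it accepts the iteration. -/
def iterationDFA {α σ : Type*} (M : DFA α σ) : DFA α (Set σ) where
  step T x := {q | (∃ p ∈ T, M.step p x = q) ∨ q = M.start ∧ ∃ p ∈ T, M.step p x ∈ M.accept}
  start := {M.start}
  accept := {T | ∃ q ∈ T, q ∈ M.accept}

namespace iterationDFA

variable {α σ : Type*} {M : DFA α σ}

theorem mem_step {T : Set σ} {x : α} {q : σ} :
    q ∈ (iterationDFA M).step T x ↔
      (∃ p ∈ T, M.step p x = q) ∨ q = M.start ∧ ∃ p ∈ T, M.step p x ∈ M.accept :=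
  Iff.rfl

theorem mem_eval_iff {w : List α} {q : σ} :
    q ∈ (iterationDFA M).eval w ↔ ∃ u v, w = u ++ v ∧ u ∈ M.accepts∗ ∧ M.eval v = q := by
  induction w using List.reverseRecOn generalizing q with
  | nil =>
    have hstart : q ∈ (iterationDFA M).start ↔ M.start = q := eq_comm
    simp [hstart, Language.nil_mem_kstar]
  | append_singleton w x ih =>
    rw [DFA.eval_append_singleton, mem_step]
    constructor
    · rintro (⟨p, hp, rfl⟩ | ⟨rfl, p, hp, hacc⟩)
      · obtain ⟨u, v, rfl, hu, rfl⟩ := ih.1 hp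
        exact ⟨u, v ++ [x], by simp, hu, by simp⟩
      · obtain ⟨u, v, rfl, hu, rfl⟩ := ih.1 hp
        rw [← DFA.eval_append_singleton] at hacc
        exact ⟨_, [], (List.append_nil _).symm, append_singleton_mem_kstar_iff.2
          ⟨u, v, rfl, hu, hacc⟩, rfl⟩
    · rintro ⟨u, v, huv, hu, rfl⟩
      rcases List.eq_nil_or_concat v with rfl | ⟨v, y, rfl⟩
      · rw [List.append_nil] at huv
        subst huv
        obtain ⟨u, v, rfl, hu, hv⟩ := append_singleton_mem_kstar_iff.1 hu
        rw [DFA.mem_accepts, DFA.eval_append_singleton] at hv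
        exact Or.inr ⟨rfl, _, ih.2 ⟨u, v, rfl, hu, rfl⟩, hv⟩
      · rw [List.concat_eq_append, ← List.append_assoc, List.append_singleton_inj] at huv
        obtain ⟨rfl, rfl⟩ := huv
        exact Or.inl ⟨_, ih.2 ⟨u, v, rfl, hu, rfl⟩, by simp⟩

theorem mem_kstar_iff {w : List α} (hw : w ≠ []) :
    w ∈ M.accepts∗ ↔ w ∈ (iterationDFA M).accepts := by
  constructor
  · intro h
    obtain ⟨w, x, rfl⟩ := (List.eq_nil_or_concat w).resolve_left hw
    rw [List.concat_eq_append] at h ⊢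
    obtain ⟨u, v, rfl, hu, hv⟩ := append_singleton_mem_kstar_iff.1 h
    exact ⟨_, mem_eval_iff.2 ⟨u, v ++ [x], List.append_assoc .., hu, rfl⟩, hv⟩
  · rintro ⟨q, hq, hacc⟩
    obtain ⟨u, v, rfl, hu, rfl⟩ := mem_eval_iff.1 hq
    exact append_mem_kstar hu hacc

theorem leftQuotient_kstar {w : List α} (hw : w ≠ []) :
    (M.accepts∗).leftQuotient w = (iterationDFA M).acceptsFrom ((iterationDFA M).eval w) := by
  rw [← Language.leftQuotient_accepts_apply]
  ext x
  exact mem_kstar_iff (List.append_ne_nil_of_left_ne_nil hw x)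

theorem eval_nonempty (w : List α) : ((iterationDFA M).eval w).Nonempty :=
  ⟨M.eval w, mem_eval_iff.2 ⟨[], w, rfl, Language.nil_mem_kstar _, rfl⟩⟩

theorem start_mem_eval {w : List α} {f : σ} (hf : f ∈ M.accept)
    (h : f ∈ (iterationDFA M).eval w) : M.start ∈ (iterationDFA M).eval w := by
  obtain ⟨u, v, rfl, hu, rfl⟩ := mem_eval_iff.1 h
  exact mem_eval_iff.2 ⟨u ++ v, [], by simp, append_mem_kstar hu hf, rfl⟩

end iterationDFA

/-- The sets that contain `s` if they contain `f`. For an accepting state `f` and the initial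
state `s` of an automaton, the nonempty ones are the candidates for the reachable states of its
iteration automaton; the empty one makes up for the quotient of the iteration by the empty word. -/
def guardedSets {σ : Type*} (f s : σ) : Set (Set σ) :=
  {T | f ∈ T → s ∈ T}

theorem ncard_guardedSets {σ : Type*} [Finite σ] {f s : σ} (hfs : f ≠ s) :
    (guardedSets f s).ncard = 2 ^ (Nat.card σ - 1) + 2 ^ (Nat.card σ - 2) := by
  have hunion : guardedSets f s = 𝒫 {f}ᶜ ∪ compl '' 𝒫 {f, s}ᶜ := by
    ext T
    simp only [guardedSets, Set.mem_union, Set.mem_powerset_iff, Set.mem_compl_image,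
      Set.compl_subset_compl, Set.subset_compl_singleton_iff, Set.insert_subset_iff,
      Set.singleton_subset_iff, Set.mem_ofPred_eq]
    tauto
  have hdisj : Disjoint (𝒫 {f}ᶜ) (compl '' 𝒫 {f, s}ᶜ) := by
    rw [Set.disjoint_left]
    rintro _ hT ⟨U, hU, rfl⟩
    exact hT (fun hfU => hU hfU (Or.inl rfl)) rfl
  rw [hunion, Set.ncard_union_eq hdisj, Set.ncard_image_of_injective _ compl_injective,
    Set.ncard_powerset, Set.ncard_powerset, Set.ncard_compl, Set.ncard_compl,
    Set.ncard_singleton, Set.ncard_pair hfs]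

theorem encard_guardedSets_sdiff_empty_add_one {σ : Type*} [Finite σ] {f s : σ} (hfs : f ≠ s) :
    (guardedSets f s \ {∅}).encard + 1 =
      ((2 ^ (Nat.card σ - 1) + 2 ^ (Nat.card σ - 2) : ℕ) : ℕ∞) := by
  have hempty : ∅ ∈ guardedSets f s := fun hf => hf.elim
  rw [Set.encard_sdiff_singleton_add_one hempty, ← (Set.toFinite _).cast_ncard_eq,
    ncard_guardedSets hfs]

section QuotientComplexity

variable {α σ : Type*} {M : DFA α σ} {f : σ}

theorem quotientComplexity_accepts_eq_card (hreach : Function.Surjective M.eval)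
    (hinj : Function.Injective M.acceptsFrom) : quotientComplexity M.accepts = ENat.card σ := by
  rw [quotientComplexity, Language.leftQuotient_accepts, Set.range_comp, hreach.range_eq,
    hinj.encard_image, Set.encard_univ]

theorem quotientComplexity_kstar_accepts_le [Finite σ] (hf : f ∈ M.accept) (hfs : f ≠ M.start) :
    quotientComplexity (M.accepts∗) ≤
      ((2 ^ (Nat.card σ - 1) + 2 ^ (Nat.card σ - 2) : ℕ) : ℕ∞) := by
  have hsub : Set.range (M.accepts∗).leftQuotient ⊆
      insert (M.accepts∗) ((iterationDFA M).acceptsFrom '' (guardedSets f M.start \ {∅})) := by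
    rintro _ ⟨w, rfl⟩
    by_cases hw : w = []
    · exact Or.inl (by rw [hw, Language.leftQuotient_nil])
    · exact Or.inr ⟨_, ⟨iterationDFA.start_mem_eval hf, (iterationDFA.eval_nonempty w).ne_empty⟩,
        (iterationDFA.leftQuotient_kstar hw).symm⟩
  calc quotientComplexity (M.accepts∗)
      ≤ ((iterationDFA M).acceptsFrom '' (guardedSets f M.start \ {∅})).encard + 1 :=
        (Set.encard_le_encard hsub).trans (Set.encard_insert_le _ _)
    _ ≤ (guardedSets f M.start \ {∅}).encard + 1 := by
        gcongr
        exact Set.encard_image_le _ _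
    _ = _ := encard_guardedSets_sdiff_empty_add_one hfs

theorem quotientComplexity_kstar_accepts_eq [Finite σ] (hf : f ∈ M.accept) (hfs : f ≠ M.start)
    (hreach : ∀ T ∈ guardedSets f M.start, T.Nonempty → ∃ w ≠ [], (iterationDFA M).eval w = T)
    (hinj : Function.Injective (iterationDFA M).acceptsFrom)
    (hne : ∀ T, (iterationDFA M).acceptsFrom T ≠ M.accepts∗) :
    quotientComplexity (M.accepts∗) =
      ((2 ^ (Nat.card σ - 1) + 2 ^ (Nat.card σ - 2) : ℕ) : ℕ∞) := by
  refine le_antisymm (quotientComplexity_kstar_accepts_le hf hfs) ?_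
  have hsub : insert (M.accepts∗)
      ((iterationDFA M).acceptsFrom '' (guardedSets f M.start \ {∅})) ⊆
        Set.range (M.accepts∗).leftQuotient := by
    rintro _ (rfl | ⟨T, ⟨hT, hTne⟩, rfl⟩)
    · exact ⟨[], rfl⟩
    · obtain ⟨w, hw, rfl⟩ := hreach T hT (Set.nonempty_iff_ne_empty.2 hTne)
      exact ⟨w, iterationDFA.leftQuotient_kstar hw⟩
  calc ((2 ^ (Nat.card σ - 1) + 2 ^ (Nat.card σ - 2) : ℕ) : ℕ∞)
      = (guardedSets f M.start \ {∅}).encard + 1 :=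
        (encard_guardedSets_sdiff_empty_add_one hfs).symm
    _ = (insert (M.accepts∗)
          ((iterationDFA M).acceptsFrom '' (guardedSets f M.start \ {∅}))).encard := by
        have hnot : M.accepts∗ ∉ (iterationDFA M).acceptsFrom '' (guardedSets f M.start \ {∅}) :=
          fun ⟨T, _, hT⟩ => hne T hT
        rw [Set.encard_insert_of_notMem hnot, hinj.encard_image]
    _ ≤ quotientComplexity (M.accepts∗) := Set.encard_le_encard hsub

theorem quotientComplexity_eq_one_iff {L : Language α} :
    quotientComplexity L = 1 ↔ L = 0 ∨ L = ⊤ := by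
  constructor
  · intro h
    obtain ⟨K, hK⟩ := Set.encard_eq_one.1 h
    have hq : ∀ w, L.leftQuotient w = L := fun w => by
      have hmem : ∀ w, L.leftQuotient w = K := fun w => hK.subset ⟨w, rfl⟩
      rw [hmem, ← hmem [], Language.leftQuotient_nil]
    have hnil : ∀ w, w ∈ L ↔ [] ∈ L := fun w => by
      rw [← List.append_nil w, ← Language.mem_leftQuotient, hq]
    by_cases h0 : [] ∈ L
    · exact Or.inr (Set.eq_univ_of_forall fun w => (hnil w).2 h0)
    · exact Or.inl (Set.eq_empty_of_forall_notMem fun w hw => h0 ((hnil w).1 hw))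
  · rintro (rfl | rfl)
    · exact Set.encard_eq_one.2 ⟨0, Set.range_eq_singleton_iff.2 fun _ => rfl⟩
    · exact Set.encard_eq_one.2 ⟨⊤, Set.range_eq_singleton_iff.2 fun _ => rfl⟩

theorem quotientComplexity_kstar_le {L : Language α} {n : ℕ} (hn : 2 ≤ n)
    (hL : quotientComplexity L = (n : ℕ∞)) :
    quotientComplexity (L∗) ≤ ((2 ^ (n - 1) + 2 ^ (n - 2) : ℕ) : ℕ∞) := by
  have hfin : Finite (Set.range L.leftQuotient) := Set.finite_of_encard_eq_coe hL
  have hcard : Nat.card (Set.range L.leftQuotient) = n := by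
    rw [Nat.card_coe_set_eq, Set.ncard]
    exact congrArg ENat.toNat hL
  by_cases h : ∃ f ∈ L.toDFA.accept, f ≠ L.toDFA.start
  · obtain ⟨f, hf, hfs⟩ := h
    have hle := quotientComplexity_kstar_accepts_le hf hfs
    rwa [Language.accepts_toDFA, hcard] at hle
  · push Not at h
    have hq : ∀ u ∈ L, L.leftQuotient u = L := fun u hu =>
      congrArg Subtype.val (h ⟨_, u, rfl⟩ (by simpa using hu))
    by_cases h0 : [] ∈ L
    · have hmul : L * L ≤ L := by
        rintro _ ⟨u, hu, v, hv, rfl⟩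
        exact (hq u hu).ge hv
      have hone : 1 ≤ L := fun _ hu => hu.symm ▸ h0
      rw [kstar_eq_one_add hmul, add_eq_right_iff_le.2 hone, hL, Nat.cast_le]
      have := (n - 1).lt_two_pow_self
      have := Nat.one_le_two_pow (n := n - 2)
      omega
    · have hL0 : L = 0 := Set.eq_empty_of_forall_notMem fun u hu => h0 <| by
        rw [← hq u hu, Language.mem_leftQuotient, List.append_nil]
        exact hu
      rw [quotientComplexity_eq_one_iff.2 (Or.inl hL0)] at hL
      norm_cast at hL
      omega

end QuotientComplexity

/-! ### The witness -/

instance : Finite Letter :=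
  .of_surjective (fun i : Fin 4 => ![Letter.a, Letter.b, Letter.c, Letter.d] i) fun x => by
    cases x
    exacts [⟨0, rfl⟩, ⟨1, rfl⟩, ⟨2, rfl⟩, ⟨3, rfl⟩]

section Witness

variable {n : ℕ} (hn : 3 ≤ n)

theorem mem_accept_starWitness {i : Fin n} : i ∈ (starWitness n hn).accept ↔ i.val = n - 2 := by
  simp only [starWitness, Set.mem_singleton_iff, Fin.ext_iff]

theorem val_starWitness_step_c (i : Fin n) :
    ((starWitness n hn).step i .c).val = if i.val = n - 1 then i.val else i.val - 1 := by
  simp only [starWitness, starWitnessStep]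
  split_ifs <;> rfl

theorem isAperiodicDFA_starWitness : IsAperiodicDFA (starWitness n hn) := by
  refine IsAperiodicDFA.of_monotone fun x i j hij => ?_
  rw [Fin.le_def] at hij ⊢
  cases x
  case a =>
    change min (i.val + 1) (n - 1) ≤ min (j.val + 1) (n - 1)
    omega
  case b => exact Nat.sub_le_sub_right hij 1
  case c =>
    simp only [val_starWitness_step_c]
    split_ifs <;> omega
  case d => exact le_rfl

theorem isStarFree_accepts_starWitness : IsStarFree (starWitness n hn).accepts :=
  (isAperiodicDFA_starWitness hn).isStarFree_accepts

theorem val_starWitness_evalFrom_replicate_a (i : Fin n) (k : ℕ) :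
    ((starWitness n hn).evalFrom i (List.replicate k .a)).val = min (i.val + k) (n - 1) := by
  induction k generalizing i with
  | zero => exact (min_eq_left (Nat.le_sub_one_of_lt i.isLt)).symm
  | succ k ih =>
    rw [List.replicate_succ, DFA.evalFrom_cons, ih]
    simp only [starWitness, starWitnessStep]
    omega

theorem starWitness_eval_surjective : Function.Surjective (starWitness n hn).eval := fun i => by
  refine ⟨List.replicate i.val .a, Fin.ext ?_⟩
  rw [DFA.eval, val_starWitness_evalFrom_replicate_a]
  simp only [starWitness]
  omega

theorem starWitness_acceptsFrom_injective :
    Function.Injective (starWitness n hn).acceptsFrom := by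
  refine .of_lt_imp_ne fun i j hij h => ?_
  have hmem (k : Fin n) : List.replicate (n - 2 - i.val) .a ∈ (starWitness n hn).acceptsFrom k ↔
      min (k.val + (n - 2 - i.val)) (n - 1) = n - 2 := by
    rw [DFA.mem_acceptsFrom, mem_accept_starWitness, val_starWitness_evalFrom_replicate_a]
  have hiff := hmem i
  rw [h, hmem j] at hiff
  omega

theorem quotientComplexity_starWitness :
    quotientComplexity (starWitness n hn).accepts = (n : ℕ∞) := by
  rw [quotientComplexity_accepts_eq_card (starWitness_eval_surjective hn)
    (starWitness_acceptsFrom_injective hn), ENat.card_eq_coe_fintype_card, Fintype.card_fin]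

variable {hn} {U V : Set ℕ} {i : Fin n}

theorem mem_iterationDFA_starWitness_step_a :
    i ∈ (iterationDFA (starWitness n hn)).step (Fin.val ⁻¹' U) .a ↔
      (i.val ≠ 0 ∧ i.val - 1 ∈ U) ∨ (i.val = n - 1 ∧ n - 1 ∈ U) ∨ (i.val = 0 ∧ n - 3 ∈ U) := by
  simp only [iterationDFA.mem_step, mem_accept_starWitness, Fin.exists_iff, Set.mem_preimage]
  simp only [starWitness, starWitnessStep, Fin.ext_iff]
  grind

theorem mem_iterationDFA_starWitness_step_b :
    i ∈ (iterationDFA (starWitness n hn)).step (Fin.val ⁻¹' U) .b ↔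
      (i.val ≠ n - 1 ∧ i.val + 1 ∈ U) ∨ (i.val = 0 ∧ (0 ∈ U ∨ n - 1 ∈ U)) := by
  simp only [iterationDFA.mem_step, mem_accept_starWitness, Fin.exists_iff, Set.mem_preimage]
  simp only [starWitness, starWitnessStep, Fin.ext_iff]
  grind

theorem mem_iterationDFA_starWitness_step_c :
    i ∈ (iterationDFA (starWitness n hn)).step (Fin.val ⁻¹' U) .c ↔
      (i.val < n - 2 ∧ i.val + 1 ∈ U) ∨ (i.val = 0 ∧ 0 ∈ U) ∨ (i.val = n - 1 ∧ n - 1 ∈ U) := by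
  simp only [iterationDFA.mem_step, mem_accept_starWitness, Fin.exists_iff, Set.mem_preimage,
    Fin.ext_iff, val_starWitness_step_c]
  simp only [starWitness]
  grind

theorem iterationDFA_starWitness_step_d {T : Set (Fin n)} (hT : T.Nonempty) :
    (iterationDFA (starWitness n hn)).step T .d = Fin.val ⁻¹' {n - 1} := by
  ext i
  simp only [iterationDFA.mem_step, mem_accept_starWitness]
  simp only [starWitness, starWitnessStep, Fin.ext_iff, Set.mem_preimage, Set.mem_singleton_iff]
  grind [Set.Nonempty]

theorem mem_acceptsFrom_iterationDFA_starWitness {T : Set (Fin n)} {w : List Letter} :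
    w ∈ (iterationDFA (starWitness n hn)).acceptsFrom T ↔
      ⟨n - 2, by omega⟩ ∈ (iterationDFA (starWitness n hn)).evalFrom T w :=
  Set.inter_singleton_nonempty

theorem replicate_a_mem_acceptsFrom_iff {T : Set (Fin n)} {k : ℕ} (hk : k ≤ n - 2) :
    List.replicate k .a ∈ (iterationDFA (starWitness n hn)).acceptsFrom T ↔
      ⟨n - 2 - k, by omega⟩ ∈ T := by
  induction k generalizing T with
  | zero => exact mem_acceptsFrom_iterationDFA_starWitness
  | succ k ih =>
    obtain ⟨U, rfl⟩ := Fin.val_injective.preimage_surjective T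
    change List.replicate k .a ∈ (iterationDFA (starWitness n hn)).acceptsFrom
      ((iterationDFA (starWitness n hn)).step (Fin.val ⁻¹' U) .a) ↔ n - 2 - (k + 1) ∈ U
    rw [ih (by omega), mem_iterationDFA_starWitness_step_a]
    grind

theorem singleton_b_mem_acceptsFrom_iff {T : Set (Fin n)} :
    [.b] ∈ (iterationDFA (starWitness n hn)).acceptsFrom T ↔ ⟨n - 1, by omega⟩ ∈ T := by
  obtain ⟨U, rfl⟩ := Fin.val_injective.preimage_surjective T
  rw [mem_acceptsFrom_iterationDFA_starWitness, DFA.evalFrom_singleton,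
    mem_iterationDFA_starWitness_step_b, Set.mem_preimage]
  grind

theorem iterationDFA_starWitness_acceptsFrom_injective :
    Function.Injective (iterationDFA (starWitness n hn)).acceptsFrom := by
  intro T T' h
  ext i
  by_cases hi : i.val = n - 1
  · rw [show i = ⟨n - 1, by omega⟩ from Fin.ext hi,
      ← singleton_b_mem_acceptsFrom_iff (hn := hn), h, singleton_b_mem_acceptsFrom_iff]
  · obtain ⟨k, hk, rfl⟩ : ∃ k, ∃ _ : k ≤ n - 2, i = ⟨n - 2 - k, by omega⟩ :=
      ⟨n - 2 - i.val, by omega, Fin.ext (by grind)⟩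
    rw [← replicate_a_mem_acceptsFrom_iff (hn := hn) hk, h, replicate_a_mem_acceptsFrom_iff hk]

theorem pair_ab_mem_acceptsFrom_iff :
    [.a, .b] ∈ (iterationDFA (starWitness n hn)).acceptsFrom (Fin.val ⁻¹' U) ↔
      n - 2 ∈ U ∨ n - 1 ∈ U := by
  change [.b] ∈ (iterationDFA (starWitness n hn)).acceptsFrom
    ((iterationDFA (starWitness n hn)).step (Fin.val ⁻¹' U) .a) ↔ _
  rw [singleton_b_mem_acceptsFrom_iff, mem_iterationDFA_starWitness_step_a]
  grind

theorem iterationDFA_starWitness_start :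
    (iterationDFA (starWitness n hn)).start = Fin.val ⁻¹' {0} := by
  ext i
  exact Fin.ext_iff

theorem iterationDFA_starWitness_acceptsFrom_ne (T : Set (Fin n)) :
    (iterationDFA (starWitness n hn)).acceptsFrom T ≠ (starWitness n hn).accepts∗ := by
  intro h
  obtain ⟨U, rfl⟩ := Fin.val_injective.preimage_surjective T
  have hU : n - 2 ∈ U := by
    have hnil := Language.nil_mem_kstar (starWitness n hn).accepts
    rwa [← h, mem_acceptsFrom_iterationDFA_starWitness] at hnil
  have hab : [.a, .b] ∈ (iterationDFA (starWitness n hn)).acceptsFrom (Fin.val ⁻¹' U) :=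
    pair_ab_mem_acceptsFrom_iff.2 (.inl hU)
  rw [h, iterationDFA.mem_kstar_iff (List.cons_ne_nil _ _), DFA.accepts,
    iterationDFA_starWitness_start, pair_ab_mem_acceptsFrom_iff] at hab
  grind

variable (hn) in
/-- Some nonempty word takes the iteration automaton of the witness from its initial state to the
set of states with numbers in `U`. Working with sets of natural numbers allows a set of states to
be shifted by a plain set-builder expression; numbers that are not below `n` are ignored. -/
def StarReachable (U : Set ℕ) : Prop :=
  ∃ w ≠ [], (iterationDFA (starWitness n hn)).eval w = Fin.val ⁻¹' U

namespace StarReachable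

theorem step (hU : StarReachable hn U) (x : Letter)
    (hV : ∀ i : Fin n,
      i ∈ (iterationDFA (starWitness n hn)).step (Fin.val ⁻¹' U) x ↔ i.val ∈ V) :
    StarReachable hn V := by
  obtain ⟨w, -, hw⟩ := hU
  refine ⟨w ++ [x], by simp, ?_⟩
  rw [DFA.eval_append_singleton, hw]
  exact Set.ext hV

theorem singleton_last : StarReachable hn {n - 1} :=
  ⟨[.d], List.cons_ne_nil _ _, iterationDFA_starWitness_step_d (Set.singleton_nonempty _)⟩

theorem congr (hU : StarReachable hn U) (hV : ∀ i < n, i ∈ U ↔ i ∈ V) : StarReachable hn V := by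
  obtain ⟨w, hw, h⟩ := hU
  exact ⟨w, hw, h.trans (Set.ext fun i => hV i i.isLt)⟩

theorem insert_one (hU : StarReachable hn U) (hlast : n - 1 ∈ U) :
    StarReachable hn {i | i = 1 ∨ (i ≠ 0 ∧ i ∈ U) ∨ i = 0 ∧ (n - 2 ∈ U ∨ n = 3)} := by
  have hdown : StarReachable hn {i | i = 0 ∨ i ≠ n - 1 ∧ i + 1 ∈ U} := by
    refine hU.step .b fun i => ?_
    rw [mem_iterationDFA_starWitness_step_b]
    grind
  refine hdown.step .a fun i => ?_
  have hn3 : n - 3 + 1 = n - 2 := by omega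
  rw [mem_iterationDFA_starWitness_step_a]
  simp only [Set.mem_ofPred_eq]
  grind

theorem of_zero_mem_iff_of_le {j : ℕ} (hj : j ≤ n - 2) (hlast : n - 1 ∈ U)
    (h0 : 0 ∈ U ↔ n - 2 ∈ U) (hle : ∀ i ∈ U, i < n - 1 → i ≤ j) : StarReachable hn U := by
  induction j generalizing U with
  | zero => exact singleton_last.congr (by grind)
  | succ j ih =>
    have hdown : StarReachable hn {i | i = n - 1 ∨ i ≠ 0 ∧ i ≤ j ∧ i + 1 ∈ U} :=
      ih (by omega) (by grind) (by grind) (by grind)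
    have herase : StarReachable hn {i | (i ≠ 0 ∧ i ≠ 1 ∧ i ∈ U) ∨ i = 0 ∧ n - 2 ∈ U ∧ n ≠ 3} := by
      refine hdown.step .a fun i => ?_
      rw [mem_iterationDFA_starWitness_step_a]
      grind
    by_cases h1 : 1 ∈ U
    · refine (herase.insert_one (by grind)).congr fun i _ => ?_
      simp only [Set.mem_ofPred_eq]
      grind
    · exact herase.congr (by grind)

theorem of_zero_mem_iff (hlast : n - 1 ∈ U) (h0 : 0 ∈ U ↔ n - 2 ∈ U) : StarReachable hn U :=
  of_zero_mem_iff_of_le le_rfl hlast h0 fun _ _ hi => Nat.le_sub_one_of_lt hi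

theorem of_last_mem (hlast : n - 1 ∈ U) (hU : n - 2 ∈ U → 0 ∈ U) : StarReachable hn U := by
  by_cases h0 : 0 ∈ U ↔ n - 2 ∈ U
  · exact of_zero_mem_iff hlast h0
  · have hshift : StarReachable hn
        {i | i = n - 1 ∨ (i ≠ 0 ∧ i - 1 ∈ U) ∨ i = 0 ∧ n - 3 ∈ U} :=
      of_zero_mem_iff (.inl rfl) (by grind)
    refine hshift.step .c fun i => ?_
    rw [mem_iterationDFA_starWitness_step_c]
    grind

theorem of_zero_mem_of_mem {i k : ℕ} (h0 : 0 ∈ U) (hi : i ∈ U) (hik : i + k = n - 1) :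
    StarReachable hn U := by
  induction k generalizing U i with
  | zero => exact of_last_mem (hik ▸ hi) fun _ => h0
  | succ k ih =>
    by_cases hlast : n - 1 ∈ U
    · exact of_last_mem hlast fun _ => h0
    · have hshift : StarReachable hn {i | i - 1 ∈ U} := ih (i := i + 1) h0 hi (by omega)
      refine hshift.step .b fun i => ?_
      rw [mem_iterationDFA_starWitness_step_b]
      grind

theorem of_mem_of_lt {i : ℕ} (hi : i ∈ U) (hin : i < n) (hU : n - 2 ∈ U → 0 ∈ U) :
    StarReachable hn U := by
  induction i generalizing U with
  | zero => exact of_zero_mem_of_mem hi hi (zero_add _)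
  | succ i ih =>
    by_cases h0 : 0 ∈ U
    · exact of_zero_mem_of_mem h0 h0 (zero_add _)
    by_cases hlast : n - 1 ∈ U
    · exact of_last_mem hlast hU
    have hshift : StarReachable hn {i | i + 1 < n ∧ i + 1 ∈ U} :=
      ih ⟨hin, hi⟩ (by omega) (by grind)
    refine hshift.step .a fun i => ?_
    rw [mem_iterationDFA_starWitness_step_a]
    by_cases hi0 : i.val = 0 <;> grind

end StarReachable

theorem quotientComplexity_kstar_starWitness :
    quotientComplexity ((starWitness n hn).accepts∗) =
      ((2 ^ (n - 1) + 2 ^ (n - 2) : ℕ) : ℕ∞) := by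
  have hfs : (⟨n - 2, by omega⟩ : Fin n) ≠ (starWitness n hn).start :=
    Fin.ne_of_val_ne (by simp only [starWitness]; omega)
  rw [quotientComplexity_kstar_accepts_eq rfl hfs ?_ iterationDFA_starWitness_acceptsFrom_injective
    iterationDFA_starWitness_acceptsFrom_ne, Nat.card_eq_fintype_card, Fintype.card_fin]
  rintro T hT ⟨i, hi⟩
  obtain ⟨U, rfl⟩ := Fin.val_injective.preimage_surjective T
  exact StarReachable.of_mem_of_lt hi i.isLt hT

end Witness

/-! ### Languages of quotient complexity one and two -/

section LeastComplexity

variable {α : Type*}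

theorem kstar_top : (⊤ : Language α)∗ = ⊤ :=
  top_le_iff.1 le_kstar

theorem leftQuotient_one_of_ne_nil {w : List α} (hw : w ≠ []) :
    (1 : Language α).leftQuotient w = 0 :=
  Set.eq_empty_of_forall_notMem fun _ h => hw (List.append_eq_nil_iff.1 h).1

theorem quotientComplexity_one [Nonempty α] : quotientComplexity (1 : Language α) = 2 := by
  have hrange : Set.range (1 : Language α).leftQuotient = {1, 0} := by
    refine Set.Subset.antisymm ?_ ?_
    · rintro _ ⟨w, rfl⟩
      by_cases hw : w = []
      · exact .inl (by rw [hw, Language.leftQuotient_nil])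
      · exact .inr (leftQuotient_one_of_ne_nil hw)
    · rintro _ (rfl | rfl)
      · exact ⟨[], Language.leftQuotient_nil _⟩
      · exact ⟨[Classical.arbitrary α], leftQuotient_one_of_ne_nil (List.cons_ne_nil _ _)⟩
  have h10 : (1 : Language α) ≠ 0 := Set.singleton_ne_empty []
  rw [quotientComplexity, hrange, Set.encard_pair h10]

theorem isGreatest_quotientComplexity_kstar [Nonempty α] :
    IsGreatest {k : ℕ∞ | ∃ L : Language α, IsStarFree L ∧ quotientComplexity L = 1 ∧
      quotientComplexity (L∗) = k} 2 := by
  constructor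
  · exact ⟨0, .zero, quotientComplexity_eq_one_iff.2 (.inl rfl),
      by rw [kstar_zero, quotientComplexity_one]⟩
  · rintro _ ⟨L, -, hL, rfl⟩
    rcases quotientComplexity_eq_one_iff.1 hL with rfl | rfl
    · rw [kstar_zero, quotientComplexity_one]
    · rw [kstar_top, quotientComplexity_eq_one_iff.2 (.inr rfl)]
      exact one_le_two

end LeastComplexity

/-- The words in which the letter `x` occurs. Over an alphabet with a further letter they form the
witness of quotient complexity two. -/
def wordsContaining {α : Type*} (x : α) : Language α :=
  {w | x ∈ w}

section WordsContaining

variable {α : Type*} {x y : α} {w : List α}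

theorem isStarFree_wordsContaining : IsStarFree (wordsContaining x) := by
  have heq : wordsContaining x = ⊤ * {[x]} * ⊤ := Set.ext fun _ =>
    mem_top_mul_singleton_mul_top.symm
  exact heq ▸ .top_mul_singleton_mul_top [x]

theorem wordsContaining_mul_le : wordsContaining x * wordsContaining x ≤ wordsContaining x := by
  rintro _ ⟨u, hu, v, -, rfl⟩
  exact List.mem_append_left v hu

theorem leftQuotient_wordsContaining_of_mem (hx : x ∈ w) :
    (wordsContaining x).leftQuotient w = ⊤ :=
  Set.eq_univ_of_forall fun v => List.mem_append_left v hx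

theorem leftQuotient_wordsContaining_of_notMem (hx : x ∉ w) :
    (wordsContaining x).leftQuotient w = wordsContaining x :=
  Set.ext fun _ => List.mem_append.trans (or_iff_right hx)

theorem wordsContaining_ne_top : wordsContaining x ≠ ⊤ := fun h =>
  List.not_mem_nil (Set.eq_univ_iff_forall.1 h [])

theorem quotientComplexity_wordsContaining : quotientComplexity (wordsContaining x) = 2 := by
  have hrange : Set.range (wordsContaining x).leftQuotient = {wordsContaining x, ⊤} := by
    refine Set.Subset.antisymm ?_ ?_
    · rintro _ ⟨w, rfl⟩
      by_cases hx : x ∈ w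
      · exact .inr (leftQuotient_wordsContaining_of_mem hx)
      · exact .inl (leftQuotient_wordsContaining_of_notMem hx)
    · rintro _ (rfl | rfl)
      · exact ⟨[], Language.leftQuotient_nil _⟩
      · exact ⟨[x], leftQuotient_wordsContaining_of_mem (List.mem_singleton_self x)⟩
  rw [quotientComplexity, hrange, Set.encard_pair wordsContaining_ne_top]

theorem leftQuotient_one_add_of_ne_nil {L : Language α} (hw : w ≠ []) :
    (1 + L).leftQuotient w = L.leftQuotient w :=
  calc (1 + L).leftQuotient w = (1 : Language α).leftQuotient w + L.leftQuotient w := rfl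
    _ = L.leftQuotient w := by rw [leftQuotient_one_of_ne_nil hw, zero_add]

theorem range_leftQuotient_one_add_wordsContaining (hxy : x ≠ y) :
    Set.range (1 + wordsContaining x).leftQuotient =
      {1 + wordsContaining x, wordsContaining x, ⊤} := by
  refine Set.Subset.antisymm ?_ ?_
  · rintro _ ⟨w, rfl⟩
    by_cases hw : w = []
    · exact .inl (by rw [hw, Language.leftQuotient_nil])
    rw [leftQuotient_one_add_of_ne_nil hw]
    by_cases hx : x ∈ w
    · exact .inr (.inr (leftQuotient_wordsContaining_of_mem hx))
    · exact .inr (.inl (leftQuotient_wordsContaining_of_notMem hx))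
  · rintro _ (rfl | rfl | rfl)
    · exact ⟨[], Language.leftQuotient_nil _⟩
    · refine ⟨[y], (leftQuotient_one_add_of_ne_nil (List.cons_ne_nil _ _)).trans ?_⟩
      exact leftQuotient_wordsContaining_of_notMem (List.mem_singleton.not.2 hxy)
    · refine ⟨[x], (leftQuotient_one_add_of_ne_nil (List.cons_ne_nil _ _)).trans ?_⟩
      exact leftQuotient_wordsContaining_of_mem (List.mem_singleton_self x)

theorem quotientComplexity_kstar_wordsContaining (hxy : x ≠ y) :
    quotientComplexity ((wordsContaining x)∗) = 3 := by
  have hnil : 1 + wordsContaining x ≠ wordsContaining x := fun h =>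
    List.not_mem_nil (h.le (show [] ∈ 1 + wordsContaining x from .inl rfl))
  have htop : 1 + wordsContaining x ≠ ⊤ := fun h => by
    rcases Set.eq_univ_iff_forall.1 h [y] with h1 | hx
    · exact List.cons_ne_nil _ _ h1
    · exact hxy (List.mem_singleton.1 hx)
  have hnotMem : 1 + wordsContaining x ∉ ({wordsContaining x, ⊤} : Set (Language α)) := by
    rintro (h | h)
    exacts [hnil h, htop h]
  rw [kstar_eq_one_add wordsContaining_mul_le, quotientComplexity,
    range_leftQuotient_one_add_wordsContaining hxy, Set.encard_insert_of_notMem hnotMem,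
    Set.encard_pair wordsContaining_ne_top]
  rfl

end WordsContaining

theorem theorem4_general :
    (∀ n : ℕ, 2 ≤ n → ∃ L : Language Letter, IsStarFree L ∧ quotientComplexity L = (n : ℕ∞) ∧
      quotientComplexity (L∗) = ((2 ^ (n - 1) + 2 ^ (n - 2) : ℕ) : ℕ∞)) ∧
    (∀ (n : ℕ) (hn : 3 ≤ n), IsAperiodicDFA (starWitness n hn) ∧
      IsStarFree (starWitness n hn).accepts ∧
      quotientComplexity (starWitness n hn).accepts = (n : ℕ∞) ∧
      quotientComplexity ((starWitness n hn).accepts∗) =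
        ((2 ^ (n - 1) + 2 ^ (n - 2) : ℕ) : ℕ∞)) ∧
    (∀ (α : Type*) (n : ℕ), 2 ≤ n → ∀ L : Language α, quotientComplexity L = (n : ℕ∞) →
      quotientComplexity (L∗) ≤ ((2 ^ (n - 1) + 2 ^ (n - 2) : ℕ) : ℕ∞)) ∧
    (∀ (α : Type*) [Nonempty α],
      IsGreatest {k : ℕ∞ | ∃ L : Language α, IsStarFree L ∧ quotientComplexity L = 1 ∧
        quotientComplexity (L∗) = k} 2) := by
  have hwitness : ∀ (n : ℕ) (hn : 3 ≤ n), IsAperiodicDFA (starWitness n hn) ∧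
      IsStarFree (starWitness n hn).accepts ∧
      quotientComplexity (starWitness n hn).accepts = (n : ℕ∞) ∧
      quotientComplexity ((starWitness n hn).accepts∗) =
        ((2 ^ (n - 1) + 2 ^ (n - 2) : ℕ) : ℕ∞) := fun n hn =>
    ⟨isAperiodicDFA_starWitness hn, isStarFree_accepts_starWitness hn,
      quotientComplexity_starWitness hn, quotientComplexity_kstar_starWitness⟩
  refine ⟨fun n hn => ?_, hwitness, fun α n hn L hL => quotientComplexity_kstar_le hn hL,
    fun α _ => isGreatest_quotientComplexity_kstar⟩
  rcases hn.eq_or_lt with rfl | hn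
  · have hab : Letter.a ≠ Letter.b := Letter.noConfusion
    exact ⟨wordsContaining .a, isStarFree_wordsContaining, quotientComplexity_wordsContaining,
      quotientComplexity_kstar_wordsContaining hab⟩
  · exact ⟨_, (hwitness n hn).2⟩

theorem theorem4 :
    -- for every `n ≥ 2` some quaternary star-free language meets the bound
    (∀ n : ℕ, 2 ≤ n → ∃ L : Language Letter, IsStarFree L ∧ quotientComplexity L = (n : ℕ∞) ∧
      quotientComplexity (L∗) = ((2 ^ (n - 1) + 2 ^ (n - 2) : ℕ) : ℕ∞)) ∧
    -- for `n ≥ 3` the language of the aperiodic automaton `D_n(a, b, c, d)` is such a language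
    (∀ (n : ℕ) (hn : 3 ≤ n), IsAperiodicDFA (starWitness n hn) ∧
      IsStarFree (starWitness n hn).accepts ∧
      quotientComplexity (starWitness n hn).accepts = (n : ℕ∞) ∧
      quotientComplexity ((starWitness n hn).accepts∗) =
        ((2 ^ (n - 1) + 2 ^ (n - 2) : ℕ) : ℕ∞)) ∧
    -- for `n ≥ 2` this number is an upper bound for all regular languages
    (∀ (α : Type*) [Finite α] [Nonempty α] (n : ℕ), 2 ≤ n →
      ∀ L : Language α, L.IsRegular → quotientComplexity L = (n : ℕ∞) →
        quotientComplexity (L∗) ≤ ((2 ^ (n - 1) + 2 ^ (n - 2) : ℕ) : ℕ∞)) ∧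
    -- for `n = 1` the tight upper bound is `2`
    (∀ (α : Type*) [Finite α] [Nonempty α],
      IsGreatest {k : ℕ∞ | ∃ L : Language α, IsStarFree L ∧ quotientComplexity L = 1 ∧
        quotientComplexity (L∗) = k} 2) :=
  theorem4_general.imp_right <| .imp_right <| .imp
    (fun h α _ _ n hn L _ => h α n hn L) fun h α _ _ => h α
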